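/- Let $S$ be a stabilizer group on $n$ qubits, i.e. an abelian subgroup of the $n$-qubit Pauli group, let $\mathcal G\subset S$ be a set that generates $S$, and let $\mathcal C=\{|\psi\rangle\in(\mathbb C^2)^{\otimes n} : s|\psi\rangle=|\psi\rangle\ \ \forall s\in S\}$ be its stabilizer code. Suppose that $\mathcal C$ encodes $k\ge 1$ qubits, i.e. $\mathcal C\cong(\mathbb C^2)^{\otimes k}$. The connectivity graph $G=(V,E)$ of $\mathcal G$ has $V=[n]$, and two distinct qubits are adjacent if and only if some $g\in\mathcal G$ has both of them in its support. Distances in $G$ are graph distances (infinite between different components), and the ball of radius $R$ centred at $v$ is the set of vertices at distance at most $R$ from $v$; $b_{\max}(R)$ denotes the largest size of a ball of radius $R$ in $G$. A set $U\subset[n]$ is correctable if there is a completely positive trace-preserving map $\mathcal R_U$ with $\mathcal R_U(\operatorname{tr}_U\rho)=\rho$ for every state $\rho$ supported on $\mathcal C$. The distance $d$ of $\mathcal C$ is the size of the smallest non-correctable set of qubits. $G$ has Nagata dimension at most $1$ at scale $r$ with constant $c>0$ if there are two collections $\mathfrak B_1,\mathfrak B_2$ of subsets of $V$ whose members together cover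 $V$, such that for $i=1,2$ any two vertices in two distinct members of $\mathfrak B_i$ are at distance at least $r$, and any two vertices in the same member of $\mathfrak B_i$ are at distance at most $cr$. If $G$ has Nagata dimension at most $1$ at scale $2$ with constant $c$, then \[ d\le b_{\max}(2c). \] More generally, if $G$ has Nagata dimension at most $1$ at some real scale $r\ge 2$ with constant $c$, then \[ d\le b_{\max}(cr). \] -/

import Mathlib

open scoped ComplexOrder

namespace QStab

/-! ### Qubits, Pauli matrices and stabilizer groups -/

/-- Labels of the computational basis of the qubits indexed by `ι`. -/
abbrev Bits (ι : Type*) := ι → Fin 2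

/-- Operators on the Hilbert space `(ℂ²)^{⊗ ι}`, in the computational basis. -/
abbrev Op (ι : Type*) := Matrix (Bits ι) (Bits ι) ℂ

/-- The labels of the four one-qubit Pauli matrices. -/
inductive Pauli
  | I
  | X
  | Y
  | Z

/-- The one-qubit Pauli matrices. -/
def Pauli.mat : Pauli → Matrix (Fin 2) (Fin 2) ℂ
  | .I => !![1, 0; 0, 1]
  | .X => !![0, 1; 1, 0]
  | .Y => !![0, -Complex.I; Complex.I, 0]
  | .Z => !![1, 0; 0, -1]

/-- The tensor product of the one-qubit Pauli matrices `P 0, …, P (n-1)`. -/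
def pauliString {n : ℕ} (P : Fin n → Pauli) : Op (Fin n) :=
  fun x y => ∏ i, (P i).mat (x i) (y i)

/-- `A` is `z` times the Pauli string `P`, where `z` is one of the phases `1, i, -1, -i`. -/
def IsPhasedString {n : ℕ} (A : Op (Fin n)) (z : ℂ) (P : Fin n → Pauli) : Prop :=
  z ^ 4 = 1 ∧ A = z • pauliString P

/-- Membership in the `n`-qubit Pauli group. -/
def IsPauli {n : ℕ} (A : Op (Fin n)) : Prop :=
  ∃ z P, IsPhasedString A z P

/-- The support of a Pauli operator: the qubits on which its string is not the identity.
(The string is determined by the operator, see `supp_eq`.) -/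
def supp {n : ℕ} (A : Op (Fin n)) : Set (Fin n) :=
  {i | ∃ z P, IsPhasedString A z P ∧ P i ≠ Pauli.I}

theorem Pauli.eq_of_smul {p q : Pauli} {s t : ℂ} (hs : s ≠ 0)
    (h : ∀ a b, s * p.mat a b = t * q.mat a b) : p = q := by
  have h00 := h 0 0
  have h01 := h 0 1
  have h10 := h 1 0
  have h11 := h 1 1
  cases p <;> cases q <;> first
    | rfl
    | (exfalso
       simp [Pauli.mat] at h00 h01 h10 h11
       grind [Complex.I_ne_zero])

theorem pauliString_update {n : ℕ} (P : Fin n → Pauli) (x y : Bits (Fin n)) (i : Fin n)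
    (a b : Fin 2) :
    pauliString P (Function.update x i a) (Function.update y i b) =
      (P i).mat a b * ∏ j ∈ Finset.univ.erase i, (P j).mat (x j) (y j) := by
  unfold pauliString
  rw [← Finset.mul_prod_erase _ _ (Finset.mem_univ i)]
  congr 1
  · simp
  · refine Finset.prod_congr rfl fun j hj => ?_
    have hji : j ≠ i := Finset.ne_of_mem_erase hj
    simp [Function.update_of_ne hji]

/-- A Pauli operator determines its string. -/
theorem IsPhasedString.unique {n : ℕ} {A : Op (Fin n)} {z w : ℂ} {P Q : Fin n → Pauli}
    (hP : IsPhasedString A z P) (hQ : IsPhasedString A w Q) : P = Q := by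
  funext i
  have hz : z ≠ 0 := by
    rintro rfl
    have := hP.1
    norm_num at this
  have hy : ∀ p : Pauli, ∃ b, p.mat 0 b ≠ 0 := by
    intro p
    cases p
    · exact ⟨0, by simp [Pauli.mat]⟩
    · exact ⟨1, by simp [Pauli.mat]⟩
    · exact ⟨1, by simp [Pauli.mat]⟩
    · exact ⟨0, by simp [Pauli.mat]⟩
  choose f hf using hy
  have hc : ∏ j ∈ Finset.univ.erase i, (P j).mat 0 (f (P j)) ≠ 0 :=
    Finset.prod_ne_zero_iff.mpr fun j _ => hf _
  refine Pauli.eq_of_smul (s := z * ∏ j ∈ Finset.univ.erase i, (P j).mat 0 (f (P j)))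
    (t := w * ∏ j ∈ Finset.univ.erase i, (Q j).mat 0 (f (P j))) (mul_ne_zero hz hc) ?_
  intro a b
  have h := congrFun (congrFun (hP.2.symm.trans hQ.2)
    (Function.update (fun _ => 0) i a)) (Function.update (fun j => f (P j)) i b)
  simp only [Matrix.smul_apply, smul_eq_mul, pauliString_update] at h
  linear_combination h

theorem supp_eq {n : ℕ} {A : Op (Fin n)} {z : ℂ} {P : Fin n → Pauli}
    (h : IsPhasedString A z P) : supp A = {i | P i ≠ Pauli.I} := by
  ext i
  constructor
  · rintro ⟨w, Q, hQ, hi⟩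
    rw [h.unique hQ]
    exact hi
  · exact fun hi => ⟨z, P, h, hi⟩

/-- The group of unitary operators on `n` qubits. -/
abbrev UGroup (n : ℕ) := Matrix.unitaryGroup (Bits (Fin n)) ℂ

/-- A stabilizer group: an abelian group of Pauli operators. -/
def IsStabilizerGroup {n : ℕ} (S : Subgroup (UGroup n)) : Prop :=
  (∀ s ∈ S, IsPauli (s : Op (Fin n))) ∧ ∀ s ∈ S, ∀ t ∈ S, s * t = t * s

/-- The stabilizer code of `S`: the vectors fixed by every element of `S`. -/
def codeSpace {n : ℕ} (S : Subgroup (UGroup n)) : Submodule ℂ (Bits (Fin n) → ℂ) where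
  carrier := {ψ | ∀ s ∈ S, (s : Op (Fin n)).mulVec ψ = ψ}
  zero_mem' := fun s _ => Matrix.mulVec_zero _
  add_mem' := fun ha hb s hs => by rw [Matrix.mulVec_add, ha s hs, hb s hs]
  smul_mem' := fun a ψ hψ s hs => by rw [Matrix.mulVec_smul, hψ s hs]

/-- The code `C` encodes `k` qubits: `C ≅ (ℂ²)^{⊗ k}`. -/
def Encodes {n : ℕ} (C : Submodule ℂ (Bits (Fin n) → ℂ)) (k : ℕ) : Prop :=
  Nonempty (C ≃ₗ[ℂ] (Bits (Fin k) → ℂ))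

/-! ### Correctable sets and the distance -/

/-- The bit string on all qubits made of `e` on `E` and `a` off `E`. -/
def glue {n : ℕ} (E : Finset (Fin n)) (e : Bits {i // i ∈ E}) (a : Bits {i // i ∉ E}) :
    Bits (Fin n) :=
  fun i => if h : i ∈ E then e ⟨i, h⟩ else a ⟨i, h⟩

/-- The partial trace over the qubits of `E`. -/
def partialTrace {n : ℕ} (E : Finset (Fin n)) (ρ : Op (Fin n)) : Op {i // i ∉ E} :=
  fun a b => ∑ e : Bits {i // i ∈ E}, ρ (glue E e a) (glue E e b)

/-- `id ⊗ Φ`, acting on matrices with an `m`-dimensional ancilla. -/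
def ampliation {α β : Type*} (Φ : Matrix α α ℂ →ₗ[ℂ] Matrix β β ℂ) (m : ℕ)
    (M : Matrix (Fin m × α) (Fin m × α) ℂ) : Matrix (Fin m × β) (Fin m × β) ℂ :=
  fun p q => Φ (fun a a' => M (p.1, a) (q.1, a')) p.2 q.2

/-- Completely positive and trace preserving linear maps. -/
def IsCPTP {α β : Type*} [Fintype α] [Fintype β]
    (Φ : Matrix α α ℂ →ₗ[ℂ] Matrix β β ℂ) : Prop :=
  (∀ (m : ℕ) (M : Matrix (Fin m × α) (Fin m × α) ℂ),
    M.PosSemidef → (ampliation Φ m M).PosSemidef) ∧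
  ∀ M : Matrix α α ℂ, (Φ M).trace = M.trace

/-- `ρ` is a state (density matrix) supported on the code space `C`. -/
def IsStateOn {n : ℕ} (C : Submodule ℂ (Bits (Fin n) → ℂ)) (ρ : Op (Fin n)) : Prop :=
  ρ.PosSemidef ∧ ρ.trace = 1 ∧ ∀ v, ρ.mulVec v ∈ C

/-- The set `E` of qubits is correctable for the code `C`: a quantum channel recovers every
state of the code after the qubits of `E` have been lost. -/
def Correctable {n : ℕ} (C : Submodule ℂ (Bits (Fin n) → ℂ)) (E : Finset (Fin n)) : Prop :=
  ∃ R : Op {i // i ∉ E} →ₗ[ℂ] Op (Fin n),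
    IsCPTP R ∧ ∀ ρ, IsStateOn C ρ → R (partialTrace E ρ) = ρ

/-- The distance of a code: the cardinality of the smallest set of qubits that is not
correctable (`⊤` if every set is correctable). -/
noncomputable def distance {n : ℕ} (C : Submodule ℂ (Bits (Fin n) → ℂ)) : ℕ∞ :=
  ⨅ (E : Finset (Fin n)) (_ : ¬ Correctable C E), (E.card : ℕ∞)

/-! ### The connectivity graph and the Nagata dimension -/

/-- The connectivity graph of a set of generators: distinct qubits are adjacent if and only if
some generator acts on both. -/
def connectivityGraph {n : ℕ} (gens : Set (UGroup n)) : SimpleGraph (Fin n) where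
  Adj u v := u ≠ v ∧ ∃ g ∈ gens, u ∈ supp (g : Op (Fin n)) ∧ v ∈ supp (g : Op (Fin n))
  symm := ⟨fun _ _ h => ⟨h.1.symm, h.2.imp fun _ hg => ⟨hg.1, hg.2.2, hg.2.1⟩⟩⟩
  loopless := ⟨fun _ h => h.1 rfl⟩

/-- The graph distance of `u` and `v` is at most `D`; vertices in different components are at
infinite distance. -/
def DistLE {V : Type*} (G : SimpleGraph V) (u v : V) (D : ℝ) : Prop :=
  G.Reachable u v ∧ (G.dist u v : ℝ) ≤ D

/-- The graph distance of `u` and `v` is at least `D`; vertices in different components are at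
infinite distance. -/
def DistGE {V : Type*} (G : SimpleGraph V) (u v : V) (D : ℝ) : Prop :=
  G.Reachable u v → D ≤ (G.dist u v : ℝ)

/-- The ball of radius `R` with centre `v`. -/
def ball {V : Type*} (G : SimpleGraph V) (v : V) (R : ℝ) : Set V :=
  {w | DistLE G v w R}

/-- The largest size of a ball of radius `R`. -/
noncomputable def bMax {V : Type*} [Fintype V] (G : SimpleGraph V) (R : ℝ) : ℕ :=
  Finset.univ.sup fun v => (ball G v R).ncard

/-- A collection of sets is `r`-separated if the vertices of any two distinct members are at
distance at least `r`. -/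
def IsSeparated {V : Type*} (G : SimpleGraph V) (r : ℝ) (𝓑 : Set (Set V)) : Prop :=
  ∀ A ∈ 𝓑, ∀ B ∈ 𝓑, A ≠ B → ∀ u ∈ A, ∀ v ∈ B, DistGE G u v r

/-- A set of vertices is `D`-bounded if its vertices are at distance at most `D` of each
other. -/
def IsBoundedBy {V : Type*} (G : SimpleGraph V) (D : ℝ) (B : Set V) : Prop :=
  ∀ u ∈ B, ∀ v ∈ B, DistLE G u v D

/-- `G` has Nagata dimension at most `m` at scale `r` with constant `c > 0`. -/
def NagataDimAtMost {V : Type*} (G : SimpleGraph V) (m : ℕ) (r c : ℝ) : Prop :=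
  0 < c ∧ ∃ 𝓑 : Fin (m + 1) → Set (Set V),
    (⋃ i, ⋃ B ∈ 𝓑 i, B) = Set.univ ∧
    (∀ i, IsSeparated G r (𝓑 i)) ∧
    ∀ i, ∀ B ∈ 𝓑 i, IsBoundedBy G (c * r) B

end QStab

/-! Suppose `d > b_max(cr)`. A member of either collection lies in the ball of radius `cr` around
any of its points, so it has fewer than `d` elements and is correctable. On a correctable set, every
Pauli string commuting with the generators acts on the code as a scalar
(`Correctable.actsAsScalar`).

Since `r ≥ 2`, no generator meets two members of one collection. A commuting Pauli string supported
on their union therefore factors into commuting strings on the members, and it is again a scalar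
(`ActsAsScalar.union`). Only this triviality is propagated; correctability of the union is never
needed. The qubits thus split into a set `E` and its complement, both with trivial logical Pauli
operators.

This is impossible, in the spirit of no-cloning. Expanding operators in Pauli strings gives
Knill–Laflamme conditions on both sides. For `ψ` reshaped to a matrix `M_ψ` across the cut, they say
`M_ψ M_φᴴ = ⟨φ,ψ⟩ L` and `M_φᴴ M_ψ = ⟨φ,ψ⟩ K`, with `L` and `K` independent of the vectors. Together
they forbid orthogonal nonzero code vectors (`ActsAsScalar.dotProduct_ne_zero`), but such vectors
exist when `k ≥ 1`. -/

namespace QStab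

open Matrix

/-! ### Tensor products of one-qubit operators -/

/-- The tensor product of the one-qubit operators `Q i`. -/
def tensor {ι : Type*} [Fintype ι] (Q : ι → Matrix (Fin 2) (Fin 2) ℂ) : Op ι :=
  fun x y => ∏ i, Q i (x i) (y i)

theorem tensor_mul {ι : Type*} [Fintype ι] [DecidableEq ι] (P Q : ι → Matrix (Fin 2) (Fin 2) ℂ) :
    tensor P * tensor Q = tensor fun i => P i * Q i := by
  ext x y
  simp only [tensor, Matrix.mul_apply, Fintype.prod_sum, Finset.prod_mul_distrib]

theorem tensor_conjTranspose {ι : Type*} [Fintype ι] (Q : ι → Matrix (Fin 2) (Fin 2) ℂ) :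
    (tensor Q)ᴴ = tensor fun i => (Q i)ᴴ := by
  ext x y
  simp [tensor, Matrix.conjTranspose_apply]

theorem tensor_single {ι : Type*} [Fintype ι] (a b : Bits ι) :
    (tensor fun i => Matrix.single (a i) (b i) (1 : ℂ)) = Matrix.single a b 1 := by
  classical
  ext x y
  simp only [tensor, Matrix.single_apply, Finset.prod_ite_zero, Finset.prod_const_one,
    funext_iff, Finset.mem_univ, true_imp_iff, forall_and]

theorem tensor_one {ι : Type*} [Fintype ι] : tensor (fun _ : ι => 1) = 1 := by
  classical
  ext x y
  simp only [tensor, Matrix.one_apply, Finset.prod_ite_zero, Finset.prod_const_one,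
    funext_iff, Finset.mem_univ, true_imp_iff]

theorem tensor_smul {ι : Type*} [Fintype ι] (c : ι → ℂ) (Q : ι → Matrix (Fin 2) (Fin 2) ℂ) :
    (tensor fun i => c i • Q i) = (∏ i, c i) • tensor Q := by
  ext x y
  simp [tensor, Finset.prod_mul_distrib]

theorem tensor_sum {ι κ : Type*} [Fintype ι] [DecidableEq ι] [Fintype κ]
    (c : ι → κ → ℂ) (Q : κ → Matrix (Fin 2) (Fin 2) ℂ) :
    (tensor fun i => ∑ k, c i k • Q k) =
      ∑ f : ι → κ, (∏ i, c i (f i)) • tensor fun i => Q (f i) := by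
  ext x y
  simp only [tensor, Matrix.sum_apply, Matrix.smul_apply, smul_eq_mul, Fintype.prod_sum,
    Finset.prod_mul_distrib]

/-- A vector on all qubits, seen as a matrix from the qubits off `E` to those of `E`. -/
def reshape {n : ℕ} (E : Finset (Fin n)) (ψ : Bits (Fin n) → ℂ) :
    Matrix (Bits {i // i ∈ E}) (Bits {i // i ∉ E}) ℂ :=
  fun e a => ψ (glue E e a)

theorem sum_glue {n : ℕ} (E : Finset (Fin n)) {M : Type*} [AddCommMonoid M]
    (f : Bits (Fin n) → M) : ∑ x, f x = ∑ e, ∑ a, f (glue E e a) := by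
  rw [← Fintype.sum_prod_type',
    ← (Equiv.piEquivPiSubtypeProd (· ∈ E) fun _ : Fin n => Fin 2).symm.sum_comp]
  rfl

theorem glue_surjective {n : ℕ} (E : Finset (Fin n)) (x : Bits (Fin n)) :
    ∃ e a, glue E e a = x :=
  ⟨fun i => x i, fun i => x i, by funext i; simp [glue]⟩

theorem reshape_injective {n : ℕ} (E : Finset (Fin n)) :
    Function.Injective (reshape E) := by
  intro φ ψ h
  funext x
  obtain ⟨e, a, rfl⟩ := glue_surjective E x
  exact congrFun (congrFun h e) a

theorem tensor_glue {n : ℕ} (E : Finset (Fin n)) (Q : Fin n → Matrix (Fin 2) (Fin 2) ℂ)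
    (e e' : Bits {i // i ∈ E}) (a a' : Bits {i // i ∉ E}) :
    tensor Q (glue E e a) (glue E e' a') =
      tensor (fun i : {i // i ∈ E} => Q i) e e' * tensor (fun i : {i // i ∉ E} => Q i) a a' := by
  unfold tensor
  rw [← Fintype.prod_subtype_mul_prod_subtype (· ∈ E)]
  congr 1
  · exact Finset.prod_congr (by ext; simp) fun i _ => by simp [glue, i.2]
  · exact Finset.prod_congr rfl fun i _ => by simp [glue, i.2]

/-- Vectorization: factors on `E` multiply on the left and factors off `E` on the right, so reduced
states and local expectation values become matrix products. -/
theorem reshape_tensor_mulVec {n : ℕ} (E : Finset (Fin n))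
    (Q : Fin n → Matrix (Fin 2) (Fin 2) ℂ) (ψ : Bits (Fin n) → ℂ) :
    reshape E (tensor Q *ᵥ ψ) = tensor (fun i : {i // i ∈ E} => Q i) * reshape E ψ *
      (tensor fun i : {i // i ∉ E} => Q i)ᵀ := by
  ext e a
  simp only [reshape, Matrix.mulVec, dotProduct, sum_glue E, tensor_glue, Matrix.mul_apply,
    Matrix.transpose_apply, Finset.sum_mul]
  rw [Finset.sum_comm]
  exact Finset.sum_congr rfl fun _ _ => Finset.sum_congr rfl fun _ _ => by ring

theorem star_dotProduct_eq_trace {n : ℕ} (E : Finset (Fin n)) (φ ψ : Bits (Fin n) → ℂ) :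
    star φ ⬝ᵥ ψ = ((reshape E φ)ᴴ * reshape E ψ).trace := by
  simp only [dotProduct, sum_glue E, Matrix.trace, Matrix.diag, Matrix.mul_apply, reshape,
    Matrix.conjTranspose_apply, Pi.star_apply]
  exact Finset.sum_comm

theorem partialTrace_vecMulVec {n : ℕ} (E : Finset (Fin n)) (ψ : Bits (Fin n) → ℂ) :
    partialTrace E (vecMulVec ψ (star ψ)) = ((reshape E ψ)ᴴ * reshape E ψ)ᵀ := by
  ext a b
  simp [partialTrace, vecMulVec_apply, Matrix.mul_apply, reshape, mul_comm]

/-! ### Pauli strings -/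

/-- The sign of the commutation relation between two one-qubit Pauli matrices. -/
def Pauli.commSign : Pauli → Pauli → ℂ
  | .I, _ => 1
  | _, .I => 1
  | .X, .X => 1
  | .Y, .Y => 1
  | .Z, .Z => 1
  | _, _ => -1

theorem Pauli.commSign_I_right (p : Pauli) : p.commSign .I = 1 := by cases p <;> rfl

theorem Pauli.commSign_eq (p q : Pauli) : p.commSign q = 1 ∨ p.commSign q = -1 := by
  cases p <;> cases q <;> simp [Pauli.commSign]

theorem Pauli.mat_I : Pauli.I.mat = 1 := by
  simp [Pauli.mat, Matrix.one_fin_two]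

theorem Pauli.mat_mul_comm (p q : Pauli) :
    p.mat * q.mat = p.commSign q • (q.mat * p.mat) := by
  cases p <;> cases q <;> simp [Pauli.mat, Pauli.commSign]

theorem Pauli.mat_conjTranspose (p : Pauli) : p.matᴴ = p.mat := by
  cases p <;> ext i j <;> fin_cases i <;> fin_cases j <;> simp [Pauli.mat]

theorem Pauli.mat_mul_self (p : Pauli) : p.mat * p.mat = 1 := by
  cases p <;> simp [Pauli.mat, Matrix.one_fin_two]

/-- The four labels, enumerated with `I` first. -/
def Pauli.enum : Fin 4 → Pauli := ![.I, .X, .Y, .Z]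

theorem Pauli.exists_eq_sum (M : Matrix (Fin 2) (Fin 2) ℂ) :
    ∃ c : Fin 4 → ℂ, M = ∑ k, c k • (Pauli.enum k).mat := by
  -- The coefficient of a Pauli matrix `σ` is `tr(σ M) / 2`.
  refine ⟨![(M 0 0 + M 1 1) / 2, (M 0 1 + M 1 0) / 2, Complex.I * (M 0 1 - M 1 0) / 2,
    (M 0 0 - M 1 1) / 2], ?_⟩
  have := Complex.I_mul_I
  ext i j
  fin_cases i <;> fin_cases j <;>
    simp [Fin.sum_univ_four, Pauli.enum, Pauli.mat] <;> grind

theorem pauliString_eq_tensor {n : ℕ} (P : Fin n → Pauli) :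
    pauliString P = tensor fun i => (P i).mat := rfl

theorem pauliString_mul_comm {n : ℕ} (P Q : Fin n → Pauli) :
    pauliString P * pauliString Q =
      (∏ i, (P i).commSign (Q i)) • (pauliString Q * pauliString P) := by
  simp only [pauliString_eq_tensor, tensor_mul, ← tensor_smul]
  exact congrArg tensor (funext fun i => Pauli.mat_mul_comm _ _)

theorem pauliString_mul_self {n : ℕ} (P : Fin n → Pauli) :
    pauliString P * pauliString P = 1 := by
  simp only [pauliString_eq_tensor, tensor_mul, Pauli.mat_mul_self, tensor_one]

theorem prod_commSign_eq {n : ℕ} (P Q : Fin n → Pauli) :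
    ∏ i, (P i).commSign (Q i) = 1 ∨ ∏ i, (P i).commSign (Q i) = -1 := by
  induction (Finset.univ : Finset (Fin n)) using Finset.cons_induction with
  | empty => simp
  | cons a s ha ih =>
    rw [Finset.prod_cons]
    rcases ih with h | h <;> rcases Pauli.commSign_eq (P a) (Q a) with h' | h' <;>
      simp [h, h']

theorem IsPhasedString.mul_pauliString {n : ℕ} {A : Op (Fin n)} {z : ℂ} {Q : Fin n → Pauli}
    (h : IsPhasedString A z Q) (P : Fin n → Pauli) :
    pauliString P * A = (∏ i, (P i).commSign (Q i)) • (A * pauliString P) := by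
  rw [h.2, Matrix.mul_smul, pauliString_mul_comm, Matrix.smul_mul, smul_comm]

theorem IsPhasedString.commute_iff {n : ℕ} {A : Op (Fin n)} {z : ℂ} {Q : Fin n → Pauli}
    (h : IsPhasedString A z Q) (P : Fin n → Pauli) :
    Commute (pauliString P) A ↔ ∏ i, (P i).commSign (Q i) = 1 := by
  have hz : z ≠ 0 := by
    rintro rfl
    have := h.1
    norm_num at this
  constructor
  · intro hc
    -- Commuting and anticommuting at once would make the product of two invertible operators zero.
    refine (prod_commSign_eq P Q).resolve_right fun hs => ?_
    have h1 := h.mul_pauliString P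
    rw [hs, ← hc.eq, neg_one_smul] at h1
    have h2 : pauliString P * A = 0 := by
      ext x y
      exact self_eq_neg.mp (congrFun (congrFun h1 x) y)
    rw [h.2, Matrix.mul_smul, smul_eq_zero] at h2
    have h3 : (1 : Op (Fin n)) = 0 := by
      rw [← pauliString_mul_self Q, ← Matrix.one_mul (pauliString Q), ← pauliString_mul_self P,
        Matrix.mul_assoc (pauliString P), h2.resolve_left hz, Matrix.mul_zero, Matrix.zero_mul]
    exact one_ne_zero h3
  · intro hs
    have h1 := h.mul_pauliString P
    rwa [hs, one_smul] at h1

/-! ### Sets on which logical Pauli operators are trivial -/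

/-- Every Pauli string supported on `A` that commutes with the generators acts on `C` as a
scalar. -/
def ActsAsScalar {n : ℕ} (gens : Set (UGroup n)) (C : Submodule ℂ (Bits (Fin n) → ℂ))
    (A : Set (Fin n)) : Prop :=
  ∀ P : Fin n → Pauli, (∀ i, i ∉ A → P i = .I) →
    (∀ g ∈ gens, Commute (pauliString P) (g : Op (Fin n))) →
    ∃ l : ℂ, ∀ ψ ∈ C, pauliString P *ᵥ ψ = l • ψ

theorem ActsAsScalar.mono {n : ℕ} {gens : Set (UGroup n)}
    {C : Submodule ℂ (Bits (Fin n) → ℂ)} {A B : Set (Fin n)} (hAB : A ⊆ B)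
    (hB : ActsAsScalar gens C B) : ActsAsScalar gens C A :=
  fun P hP hg => hB P (fun i hi => hP i fun h => hi (hAB h)) hg

theorem pauliString_mem_codeSpace {n : ℕ} {S : Subgroup (UGroup n)} {P : Fin n → Pauli}
    (hP : ∀ s ∈ S, Commute (pauliString P) (s : Op (Fin n))) {ψ : Bits (Fin n) → ℂ}
    (hψ : ψ ∈ codeSpace S) : pauliString P *ᵥ ψ ∈ codeSpace S := by
  intro s hs
  rw [Matrix.mulVec_mulVec, ← (hP s hs).eq, ← Matrix.mulVec_mulVec, hψ s hs]

/-- A Pauli string is unitary, so its centralizer is a subgroup of the unitary group; it contains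
the generators, hence all they generate. -/
theorem commute_of_mem_closure {n : ℕ} {gens : Set (UGroup n)} {P : Fin n → Pauli}
    (hP : ∀ g ∈ gens, Commute (pauliString P) (g : Op (Fin n))) :
    ∀ s ∈ Subgroup.closure gens, Commute (pauliString P) (s : Op (Fin n)) := by
  have hu : pauliString P ∈ Matrix.unitaryGroup (Bits (Fin n)) ℂ := by
    rw [Matrix.mem_unitaryGroup_iff, Matrix.star_eq_conjTranspose]
    simp only [pauliString_eq_tensor, tensor_conjTranspose, Pauli.mat_conjTranspose]
    exact pauliString_mul_self P
  have hle : Subgroup.closure gens ≤ Subgroup.centralizer {(⟨_, hu⟩ : UGroup n)} := by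
    rw [Subgroup.closure_le]
    intro g hg
    rw [SetLike.mem_coe, Subgroup.mem_centralizer_singleton_iff]
    exact Subtype.ext (hP g hg).symm.eq
  intro s hs
  have := Subgroup.mem_centralizer_singleton_iff.mp (hle hs)
  exact (congrArg Subtype.val this).symm

theorem exists_smul_of_vecMulVec_eq {ι : Type*} {φ ψ : ι → ℂ}
    (h : vecMulVec φ (star φ) = vecMulVec ψ (star ψ)) (hψ : ψ ≠ 0) : ∃ l : ℂ, φ = l • ψ := by
  obtain ⟨j, hj⟩ := Function.ne_iff.mp hψ
  have hφ : star (φ j) ≠ 0 := by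
    intro h0
    have := congrFun (congrFun h j) j
    simp only [vecMulVec_apply, Pi.star_apply, h0, mul_zero] at this
    exact hj (by simpa using this.symm)
  refine ⟨star (ψ j) / star (φ j), funext fun i => ?_⟩
  have := congrFun (congrFun h i) j
  simp only [vecMulVec_apply, Pi.star_apply] at this
  rw [Pi.smul_apply, smul_eq_mul, div_mul_eq_mul_div, eq_div_iff hφ, this, mul_comm]

/-- The recovery map sees only the reduced state, so code states with equal reductions coincide.
Linearity lets the common norm be scaled to one and back. -/
theorem Correctable.vecMulVec_eq {n : ℕ} {C : Submodule ℂ (Bits (Fin n) → ℂ)}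
    {E : Finset (Fin n)} (h : Correctable C E) {φ ψ : Bits (Fin n) → ℂ} (hφ : φ ∈ C)
    (hψ : ψ ∈ C) (hψ0 : ψ ≠ 0) (hnorm : star φ ⬝ᵥ φ = star ψ ⬝ᵥ ψ)
    (htr : partialTrace E (vecMulVec φ (star φ)) = partialTrace E (vecMulVec ψ (star ψ))) :
    vecMulVec φ (star φ) = vecMulVec ψ (star ψ) := by
  obtain ⟨R, -, hR⟩ := h
  have hpos : 0 < star ψ ⬝ᵥ ψ := Matrix.dotProduct_star_self_pos_iff.mpr hψ0
  set N := star ψ ⬝ᵥ ψ with hN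
  have key : ∀ χ ∈ C, star χ ⬝ᵥ χ = N →
      R (partialTrace E (vecMulVec χ (star χ))) = vecMulVec χ (star χ) := by
    intro χ hχ hχN
    have hs : IsStateOn C (N⁻¹ • vecMulVec χ (star χ)) := by
      refine ⟨(Matrix.posSemidef_vecMulVec_self_star χ).smul (inv_nonneg.mpr hpos.le), ?_, ?_⟩
      · rw [Matrix.trace_smul, Matrix.trace_vecMulVec, dotProduct_comm, hχN, smul_eq_mul,
          inv_mul_cancel₀ hpos.ne']
      · intro v
        rw [Matrix.smul_mulVec, Matrix.vecMulVec_mulVec]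
        exact C.smul_mem _ (by simpa using C.smul_mem _ hχ)
    have h1 := hR _ hs
    have h2 : partialTrace E (N⁻¹ • vecMulVec χ (star χ)) =
        N⁻¹ • partialTrace E (vecMulVec χ (star χ)) := by
      ext a b
      simp [partialTrace, Finset.mul_sum]
    rw [h2, map_smul] at h1
    exact smul_right_injective _ (inv_ne_zero hpos.ne') h1
  rw [← key φ hφ hnorm, htr, key ψ hψ rfl]

/-- A Pauli string on `E` is unitary there, so it leaves the reduced state off `E` unchanged. If it
also preserves the code, recovery forces it to fix every code state up to a factor. -/
theorem Correctable.actsAsScalar {n : ℕ} {S : Subgroup (UGroup n)} {gens : Set (UGroup n)}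
    (hgens : Subgroup.closure gens = S) {E : Finset (Fin n)} (h : Correctable (codeSpace S) E) :
    ActsAsScalar gens (codeSpace S) E := by
  intro P hP hcomm
  have hS : ∀ s ∈ S, Commute (pauliString P) (s : Op (Fin n)) :=
    hgens ▸ commute_of_mem_closure hcomm
  have hres : ∀ ψ, (reshape E (pauliString P *ᵥ ψ))ᴴ * reshape E (pauliString P *ᵥ ψ) =
      (reshape E ψ)ᴴ * reshape E ψ := by
    intro ψ
    have hoff : (fun i : {i // i ∉ E} => (P i).mat) = fun _ => 1 :=
      funext fun i => by rw [hP i i.2, Pauli.mat_I]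
    rw [pauliString_eq_tensor, reshape_tensor_mulVec, hoff, tensor_one, Matrix.transpose_one,
      Matrix.mul_one, Matrix.conjTranspose_mul, Matrix.mul_assoc, ← Matrix.mul_assoc (tensor _)ᴴ,
      tensor_conjTranspose, tensor_mul]
    simp only [Pauli.mat_conjTranspose, Pauli.mat_mul_self, tensor_one, Matrix.one_mul]
  have heig : ∀ ψ ∈ codeSpace S, ∃ l : ℂ, pauliString P *ᵥ ψ = l • ψ := by
    intro ψ hψ
    by_cases h0 : ψ = 0
    · exact ⟨0, by simp [h0]⟩
    refine exists_smul_of_vecMulVec_eq (h.vecMulVec_eq (pauliString_mem_codeSpace hS hψ) hψ h0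
      ?_ ?_) h0
    · rw [star_dotProduct_eq_trace E, hres, ← star_dotProduct_eq_trace]
    · rw [partialTrace_vecMulVec, hres, ← partialTrace_vecMulVec]
  -- The factor might still depend on the vector; a linear map with every vector an eigenvector is a
  -- scalar.
  obtain ⟨l, hl⟩ := LinearMap.exists_eq_smul_id_of_forall_notLinearIndependent
    (f := (Matrix.mulVecLin (pauliString P)).restrict
      fun ψ hψ => pauliString_mem_codeSpace hS (S := S) hψ) (by
    intro ψ hli
    obtain ⟨l, hl⟩ := heig ψ ψ.2
    have := LinearIndependent.pair_iff.mp hli l (-1) (by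
      apply Subtype.ext
      rw [neg_one_smul, Submodule.coe_add, Submodule.coe_neg, Submodule.coe_smul, ← hl]
      exact add_neg_cancel _)
    simp at this)
  refine ⟨l, fun ψ hψ => ?_⟩
  exact congrArg Subtype.val (LinearMap.congr_fun hl ⟨ψ, hψ⟩)

/-- The restriction of a Pauli string to a set of qubits. -/
noncomputable def restrictString {n : ℕ} (P : Fin n → Pauli) (A : Set (Fin n)) :
    Fin n → Pauli :=
  open scoped Classical in fun i => if i ∈ A then P i else .I

theorem restrictString_of_mem {n : ℕ} (P : Fin n → Pauli) {A : Set (Fin n)} {i : Fin n}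
    (h : i ∈ A) : restrictString P A i = P i := if_pos h

theorem restrictString_of_notMem {n : ℕ} (P : Fin n → Pauli) {A : Set (Fin n)} {i : Fin n}
    (h : i ∉ A) : restrictString P A i = .I := if_neg h

theorem pauliString_eq_mul_restrictString {n : ℕ} {P : Fin n → Pauli} {A B : Set (Fin n)}
    (hd : Disjoint A B) (hP : ∀ i, i ∉ A ∪ B → P i = .I) :
    pauliString P = pauliString (restrictString P A) * pauliString (restrictString P B) := by
  simp only [pauliString_eq_tensor, tensor_mul]
  refine congrArg tensor (funext fun i => ?_)
  by_cases hA : i ∈ A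
  · rw [restrictString_of_mem P hA, restrictString_of_notMem P (hd.notMem_of_mem_left hA),
      Pauli.mat_I, mul_one]
  · rw [restrictString_of_notMem P hA, Pauli.mat_I, one_mul]
    by_cases hB : i ∈ B
    · rw [restrictString_of_mem P hB]
    · rw [restrictString_of_notMem P hB, hP i (by simp [hA, hB])]

/-- A generator meeting `A` misses `B`, so the restriction to `A` has the same commutation sign as
`P`. A generator missing `A` commutes with the restriction trivially. -/
theorem commute_restrictString {n : ℕ} {P : Fin n → Pauli} {A B : Set (Fin n)}
    (hP : ∀ i, i ∉ A ∪ B → P i = .I) {g : Op (Fin n)} (hg : IsPauli g)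
    (hsep : ∀ i ∈ A, ∀ j ∈ B, i ∈ supp g → j ∉ supp g) (hc : Commute (pauliString P) g) :
    Commute (pauliString (restrictString P A)) g := by
  obtain ⟨z, Q, hQ⟩ := hg
  rw [hQ.commute_iff] at hc ⊢
  have hnot : ∀ i, i ∉ supp g → Q i = .I := by
    intro i hi
    rw [supp_eq hQ] at hi
    simpa using hi
  by_cases hmeet : ∃ i ∈ A, i ∈ supp g
  · obtain ⟨i, hiA, hi⟩ := hmeet
    rw [← hc]
    refine Finset.prod_congr rfl fun j _ => ?_
    by_cases hjA : j ∈ A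
    · rw [restrictString_of_mem P hjA]
    · rw [restrictString_of_notMem P hjA]
      by_cases hjB : j ∈ B
      · rw [hnot j (hsep i hiA j hjB hi), Pauli.commSign_I_right, Pauli.commSign_I_right]
      · rw [hP j (by simp [hjA, hjB])]
  · refine Finset.prod_eq_one fun j _ => ?_
    by_cases hjA : j ∈ A
    · rw [hnot j fun h => hmeet ⟨j, hjA, h⟩, Pauli.commSign_I_right]
    · rw [restrictString_of_notMem P hjA]
      rfl

/-- The union of two sets that no generator connects inherits triviality of the logical Pauli
operators. -/
theorem ActsAsScalar.union {n : ℕ} {gens : Set (UGroup n)}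
    {C : Submodule ℂ (Bits (Fin n) → ℂ)} {A B : Set (Fin n)}
    (hpauli : ∀ g ∈ gens, IsPauli (g : Op (Fin n)))
    (hA : ActsAsScalar gens C A) (hB : ActsAsScalar gens C B) (hd : Disjoint A B)
    (hsep : ∀ g ∈ gens, ∀ i ∈ A, ∀ j ∈ B,
      i ∈ supp (g : Op (Fin n)) → j ∉ supp (g : Op (Fin n))) :
    ActsAsScalar gens C (A ∪ B) := by
  intro P hP hcomm
  obtain ⟨a, ha⟩ := hA (restrictString P A) (fun i hi => restrictString_of_notMem P hi)
    fun g hg => commute_restrictString hP (hpauli g hg) (hsep g hg) (hcomm g hg)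
  obtain ⟨b, hb⟩ := hB (restrictString P B) (fun i hi => restrictString_of_notMem P hi)
    fun g hg => commute_restrictString (Set.union_comm A B ▸ hP) (hpauli g hg)
      (fun i hi j hj h h' => hsep g hg j hj i hi h' h) (hcomm g hg)
  refine ⟨b * a, fun ψ hψ => ?_⟩
  rw [pauliString_eq_mul_restrictString hd hP, ← Matrix.mulVec_mulVec, hb ψ hψ,
    Matrix.mulVec_smul, ha ψ hψ, smul_smul]

theorem ActsAsScalar.empty {n : ℕ} (gens : Set (UGroup n))
    (C : Submodule ℂ (Bits (Fin n) → ℂ)) : ActsAsScalar gens C ∅ := by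
  intro P hP _
  refine ⟨1, fun ψ _ => ?_⟩
  have : pauliString P = 1 := by
    rw [pauliString_eq_tensor, ← tensor_one]
    exact congrArg tensor (funext fun i => by rw [hP i (by simp), Pauli.mat_I])
  rw [this, Matrix.one_mulVec, one_smul]

theorem ActsAsScalar.sUnion {n : ℕ} {gens : Set (UGroup n)}
    {C : Submodule ℂ (Bits (Fin n) → ℂ)} (hpauli : ∀ g ∈ gens, IsPauli (g : Op (Fin n)))
    {𝓑 : Set (Set (Fin n))} (hB : ∀ B ∈ 𝓑, ActsAsScalar gens C B)
    (hd : 𝓑.PairwiseDisjoint id)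
    (hsep : ∀ A ∈ 𝓑, ∀ B ∈ 𝓑, A ≠ B → ∀ g ∈ gens, ∀ i ∈ A, ∀ j ∈ B,
      i ∈ supp (g : Op (Fin n)) → j ∉ supp (g : Op (Fin n))) :
    ActsAsScalar gens C (⋃₀ 𝓑) := by
  induction 𝓑, Set.toFinite 𝓑 using Set.Finite.induction_on with
  | empty => simpa using ActsAsScalar.empty gens C
  | @insert A 𝓐 hA _ ih =>
    have hne : ∀ B ∈ 𝓐, A ≠ B := fun B hB h => hA (h ▸ hB)
    rw [Set.sUnion_insert]
    refine (hB A (Set.mem_insert _ _)).union hpauli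
      (ih (fun B h => hB B (Set.mem_insert_of_mem _ h)) (hd.subset (Set.subset_insert _ _))
        fun B h B' h' => hsep B (Set.mem_insert_of_mem _ h) B' (Set.mem_insert_of_mem _ h'))
      ?_ ?_
    · rw [Set.disjoint_sUnion_right]
      exact fun B h => hd (Set.mem_insert _ _) (Set.mem_insert_of_mem _ h) (hne B h)
    · rintro g hg i hi j ⟨B, h, hj⟩
      exact hsep A (Set.mem_insert _ _) B (Set.mem_insert_of_mem _ h) (hne B h) g hg i hi j hj

/-! ### The Knill–Laflamme condition -/

/-- A string that fails to commute with some generator `g` anticommutes with it. As `g` fixes both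
code vectors, the matrix element equals its own negative, so the scalar is zero. -/
theorem ActsAsScalar.exists_dotProduct_pauliString {n : ℕ} {S : Subgroup (UGroup n)}
    (hS : ∀ s ∈ S, IsPauli (s : Op (Fin n))) {gens : Set (UGroup n)} (hgens : gens ⊆ S)
    {A : Set (Fin n)} (hA : ActsAsScalar gens (codeSpace S) A) {P : Fin n → Pauli}
    (hP : ∀ i, i ∉ A → P i = .I) :
    ∃ l : ℂ, ∀ φ ∈ codeSpace S, ∀ ψ ∈ codeSpace S,
      star φ ⬝ᵥ (pauliString P *ᵥ ψ) = l * (star φ ⬝ᵥ ψ) := by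
  by_cases hcomm : ∀ g ∈ gens, Commute (pauliString P) (g : Op (Fin n))
  · obtain ⟨l, hl⟩ := hA P hP hcomm
    exact ⟨l, fun φ _ ψ hψ => by rw [hl ψ hψ, dotProduct_smul, smul_eq_mul]⟩
  · push Not at hcomm
    obtain ⟨g, hg, hnc⟩ := hcomm
    obtain ⟨z, Q, hQ⟩ := hS g (hgens hg)
    have hanti := hQ.mul_pauliString P
    rw [(prod_commSign_eq P Q).resolve_left fun h => hnc ((hQ.commute_iff P).mpr h),
      neg_one_smul] at hanti
    refine ⟨0, fun φ hφ ψ hψ => ?_⟩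
    -- The inverse of `g` also fixes `φ`, and by unitarity it is the adjoint of `g`.
    have hφ' : star φ ᵥ* (g : Op (Fin n)) = star φ := by
      have h1 := hφ _ (S.inv_mem (hgens hg))
      have h2 := congrArg star h1
      rw [Matrix.star_mulVec] at h2
      simpa [← Matrix.star_eq_conjTranspose] using h2
    have h1 : star φ ⬝ᵥ (pauliString P *ᵥ ψ) = -(star φ ⬝ᵥ (pauliString P *ᵥ ψ)) := by
      conv_lhs => rw [← hψ g (hgens hg), Matrix.mulVec_mulVec, hanti, Matrix.neg_mulVec,
        dotProduct_neg, ← Matrix.mulVec_mulVec, Matrix.dotProduct_mulVec, hφ']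
    rw [zero_mul]
    exact self_eq_neg.mp h1

theorem ActsAsScalar.exists_dotProduct_tensor {n : ℕ} {S : Subgroup (UGroup n)}
    (hS : ∀ s ∈ S, IsPauli (s : Op (Fin n))) {gens : Set (UGroup n)} (hgens : gens ⊆ S)
    {A : Set (Fin n)} (hA : ActsAsScalar gens (codeSpace S) A)
    {Q : Fin n → Matrix (Fin 2) (Fin 2) ℂ} (hQ : ∀ i, i ∉ A → Q i = 1) :
    ∃ l : ℂ, ∀ φ ∈ codeSpace S, ∀ ψ ∈ codeSpace S,
      star φ ⬝ᵥ (tensor Q *ᵥ ψ) = l * (star φ ⬝ᵥ ψ) := by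
  have hc : ∀ i, ∃ c : Fin 4 → ℂ, Q i = ∑ k, c k • (Pauli.enum k).mat ∧
      (i ∉ A → ∀ k, c k ≠ 0 → Pauli.enum k = .I) := by
    intro i
    by_cases hi : i ∈ A
    · obtain ⟨c, hc⟩ := Pauli.exists_eq_sum (Q i)
      exact ⟨c, hc, fun h => absurd hi h⟩
    -- Using only the identity label off `A` ensures that every term with nonzero coefficient is
    -- supported on `A`.
    · refine ⟨Pi.single 0 1, ?_, fun _ k hk => ?_⟩
      · rw [hQ i hi]
        simp [Pauli.enum, Pauli.mat_I]
      · have : k = 0 := by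
          by_contra h
          exact hk (Pi.single_eq_of_ne h _)
        rw [this]
        rfl
  choose c hc hcI using hc
  have hl : ∀ f : Fin n → Fin 4, ∃ l : ℂ, ∀ φ ∈ codeSpace S, ∀ ψ ∈ codeSpace S,
      star φ ⬝ᵥ (((∏ i, c i (f i)) • pauliString fun i => Pauli.enum (f i)) *ᵥ ψ) =
        l * (star φ ⬝ᵥ ψ) := by
    intro f
    by_cases h0 : ∏ i, c i (f i) = 0
    · exact ⟨0, fun φ _ ψ _ => by simp [h0]⟩
    · have hne := fun i => Finset.prod_ne_zero_iff.mp h0 i (Finset.mem_univ i)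
      obtain ⟨l, hl⟩ := hA.exists_dotProduct_pauliString hS hgens
        (P := fun i => Pauli.enum (f i)) fun i hi => hcI i hi _ (hne i)
      refine ⟨(∏ i, c i (f i)) * l, fun φ hφ ψ hψ => ?_⟩
      rw [Matrix.smul_mulVec, dotProduct_smul, hl φ hφ ψ hψ, smul_eq_mul, mul_assoc]
  choose l hl using hl
  refine ⟨∑ f, l f, fun φ hφ ψ hψ => ?_⟩
  have hQs : tensor Q =
      ∑ f : Fin n → Fin 4, (∏ i, c i (f i)) • pauliString fun i => Pauli.enum (f i) := by
    rw [show Q = _ from funext hc, tensor_sum]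
    rfl
  rw [hQs, Matrix.sum_mulVec, dotProduct_sum, Finset.sum_mul]
  exact Finset.sum_congr rfl fun f _ => hl f φ hφ ψ hψ

/-- The operators on the qubits of `E` see no difference between the states of the code. -/
theorem ActsAsScalar.exists_reshape_mul {n : ℕ} {S : Subgroup (UGroup n)}
    (hS : ∀ s ∈ S, IsPauli (s : Op (Fin n))) {gens : Set (UGroup n)} (hgens : gens ⊆ S)
    {E : Finset (Fin n)} (hE : ActsAsScalar gens (codeSpace S) E) :
    ∃ L : Op {i // i ∈ E}, ∀ φ ∈ codeSpace S, ∀ ψ ∈ codeSpace S,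
      reshape E ψ * (reshape E φ)ᴴ = (star φ ⬝ᵥ ψ) • L := by
  have h : ∀ a b : Bits {i // i ∈ E}, ∃ l : ℂ, ∀ φ ∈ codeSpace S, ∀ ψ ∈ codeSpace S,
      (reshape E ψ * (reshape E φ)ᴴ) a b = l * (star φ ⬝ᵥ ψ) := by
    intro a b
    -- The matrix unit `|b⟩⟨a|` on `E` picks out the entry `(a, b)` of the product.
    obtain ⟨l, hl⟩ := hE.exists_dotProduct_tensor hS hgens
      (Q := fun i => if h : i ∈ E then Matrix.single (b ⟨i, h⟩) (a ⟨i, h⟩) 1 else 1)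
      fun i hi => dif_neg hi
    refine ⟨l, fun φ hφ ψ hψ => ?_⟩
    rw [← hl φ hφ ψ hψ, star_dotProduct_eq_trace E, reshape_tensor_mulVec]
    have h1 : (fun i : {i // i ∈ E} => if h : (i : Fin n) ∈ E then
        Matrix.single (b ⟨i, h⟩) (a ⟨i, h⟩) (1 : ℂ) else 1) =
        fun i => Matrix.single (b i) (a i) 1 := funext fun i => dif_pos i.2
    have h2 : (fun i : {i // i ∉ E} => if h : (i : Fin n) ∈ E then
        Matrix.single (b ⟨i, h⟩) (a ⟨i, h⟩) (1 : ℂ) else 1) = fun _ => 1 :=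
      funext fun i => dif_neg i.2
    rw [h1, h2, tensor_one, tensor_single, Matrix.transpose_one, Matrix.mul_one,
      Matrix.trace_mul_comm, Matrix.mul_assoc, Matrix.trace_single_mul, one_smul]
  choose L hL using h
  refine ⟨L, fun φ hφ ψ hψ => ?_⟩
  ext a b
  exact (hL a b φ hφ ψ hψ).trans (mul_comm _ _)

/-- The operators on the qubits off `E` see no difference between the states of the code. -/
theorem ActsAsScalar.exists_mul_reshape {n : ℕ} {S : Subgroup (UGroup n)}
    (hS : ∀ s ∈ S, IsPauli (s : Op (Fin n))) {gens : Set (UGroup n)} (hgens : gens ⊆ S)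
    {E : Finset (Fin n)} (hE : ActsAsScalar gens (codeSpace S) {i | i ∉ E}) :
    ∃ L : Op {i // i ∉ E}, ∀ φ ∈ codeSpace S, ∀ ψ ∈ codeSpace S,
      (reshape E φ)ᴴ * reshape E ψ = (star φ ⬝ᵥ ψ) • L := by
  have h : ∀ a b : Bits {i // i ∉ E}, ∃ l : ℂ, ∀ φ ∈ codeSpace S, ∀ ψ ∈ codeSpace S,
      ((reshape E φ)ᴴ * reshape E ψ) a b = l * (star φ ⬝ᵥ ψ) := by
    intro a b
    obtain ⟨l, hl⟩ := hE.exists_dotProduct_tensor hS hgens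
      -- The indices are swapped relative to the operator on `E`, because factors off `E` act
      -- through their transpose.
      (Q := fun i => if h : i ∉ E then Matrix.single (a ⟨i, h⟩) (b ⟨i, h⟩) 1 else 1)
      fun i hi => dif_neg hi
    refine ⟨l, fun φ hφ ψ hψ => ?_⟩
    rw [← hl φ hφ ψ hψ, star_dotProduct_eq_trace E, reshape_tensor_mulVec]
    have h1 : (fun i : {i // i ∈ E} => if h : (i : Fin n) ∉ E then
        Matrix.single (a ⟨i, h⟩) (b ⟨i, h⟩) (1 : ℂ) else 1) = fun _ => 1 :=
      funext fun i => dif_neg (not_not_intro i.2)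
    have h2 : (fun i : {i // i ∉ E} => if h : (i : Fin n) ∉ E then
        Matrix.single (a ⟨i, h⟩) (b ⟨i, h⟩) (1 : ℂ) else 1) =
        fun i => Matrix.single (a i) (b i) 1 := funext fun i => dif_pos i.2
    rw [h1, h2, tensor_one, tensor_single, Matrix.one_mul, Matrix.transpose_single,
      ← Matrix.mul_assoc, Matrix.trace_mul_comm, Matrix.trace_single_mul, one_smul]
  choose L hL using h
  refine ⟨L, fun φ hφ ψ hψ => ?_⟩
  ext a b
  exact (hL a b φ hφ ψ hψ).trans (mul_comm _ _)

/-- If the logical Pauli operators are trivial on `E` and on its complement, then no two nonzero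
vectors of the code are orthogonal. -/
theorem ActsAsScalar.dotProduct_ne_zero {n : ℕ} {S : Subgroup (UGroup n)}
    (hS : ∀ s ∈ S, IsPauli (s : Op (Fin n))) {gens : Set (UGroup n)} (hgens : gens ⊆ S)
    {E : Finset (Fin n)} (hE : ActsAsScalar gens (codeSpace S) E)
    (hE' : ActsAsScalar gens (codeSpace S) {i | i ∉ E}) {φ ψ : Bits (Fin n) → ℂ}
    (hφ : φ ∈ codeSpace S) (hψ : ψ ∈ codeSpace S) (hφ0 : φ ≠ 0) (hψ0 : ψ ≠ 0) :
    star φ ⬝ᵥ ψ ≠ 0 := by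
  intro h0
  obtain ⟨L, hL⟩ := hE.exists_reshape_mul hS hgens
  obtain ⟨K, hK⟩ := hE'.exists_mul_reshape hS hgens
  have h1 : reshape E ψ * (reshape E φ)ᴴ = 0 := by rw [hL φ hφ ψ hψ, h0, zero_smul]
  -- Multiplying `M_ψ M_φᴴ = 0` by `M_φ` exposes `K`. The same `K` serves `ψ`, which yields `M_ψ
  -- M_ψᴴ M_ψ = 0` and so `M_ψ = 0`.
  have h2 : (star φ ⬝ᵥ φ) • (reshape E ψ * K) = 0 := by
    rw [← Matrix.mul_smul, ← hK φ hφ φ hφ, ← Matrix.mul_assoc, h1, Matrix.zero_mul]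
  have h3 : reshape E ψ * K = 0 :=
    (smul_eq_zero.mp h2).resolve_left (by simpa using hφ0)
  have h4 : reshape E ψ * ((reshape E ψ)ᴴ * reshape E ψ) = 0 := by
    rw [hK ψ hψ ψ hψ, Matrix.mul_smul, h3, smul_zero]
  have h5 : reshape E ψ = 0 := by
    rw [← Matrix.mul_assoc, Matrix.mul_assoc, Matrix.mul_conjTranspose_mul_self_eq_zero] at h4
    simpa using h4
  exact hψ0 (reshape_injective E h5)

theorem exists_orthogonal_of_encodes {n k : ℕ} {C : Submodule ℂ (Bits (Fin n) → ℂ)}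
    (hk : Encodes C k) (hk1 : 1 ≤ k) :
    ∃ φ ∈ C, ∃ ψ ∈ C, φ ≠ 0 ∧ ψ ≠ 0 ∧ star φ ⬝ᵥ ψ = 0 := by
  obtain ⟨e⟩ := hk
  have hrank : 1 < Module.finrank ℂ C := by
    rw [e.finrank_eq]
    simpa [Module.finrank_fintype_fun_eq_card] using Nat.one_lt_two_pow (by omega)
  have : Nontrivial C := Module.nontrivial_of_finrank_pos (R := ℂ) (by omega)
  obtain ⟨φ, hφ⟩ := exists_ne (0 : C)
  obtain ⟨χ, hχ⟩ : ∃ χ : C, ∀ l : ℂ, l • φ ≠ χ := by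
    by_contra! h
    exact hrank.not_ge (finrank_le_one φ h)
  have hφ0 : (φ : Bits (Fin n) → ℂ) ≠ 0 := by simpa using hφ
  have hN : star (φ : Bits (Fin n) → ℂ) ⬝ᵥ φ ≠ 0 := by simpa using hφ0
  set l := (star (φ : Bits (Fin n) → ℂ) ⬝ᵥ χ) / (star (φ : Bits (Fin n) → ℂ) ⬝ᵥ φ) with hl
  -- One Gram–Schmidt step, available since the dimension `2 ^ k` exceeds one.
  refine ⟨φ, φ.2, (χ - l • φ : C), (χ - l • φ).2, hφ0, ?_, ?_⟩
  · have := sub_ne_zero.mpr (hχ l).symm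
    exact fun h => this (Subtype.ext h)
  · simp [dotProduct_sub, hl, div_mul_cancel₀ _ hN]

/-! ### Distance and Nagata dimension -/

theorem correctable_of_card_lt_distance {n : ℕ} {C : Submodule ℂ (Bits (Fin n) → ℂ)}
    {E : Finset (Fin n)} (h : (E.card : ℕ∞) < distance C) : Correctable C E := by
  by_contra hE
  exact h.not_ge (iInf₂_le E hE)

theorem ncard_le_bMax {V : Type*} [Fintype V] {G : SimpleGraph V} {D : ℝ} {B : Set V}
    (h : IsBoundedBy G D B) : B.ncard ≤ bMax G D := by
  rcases B.eq_empty_or_nonempty with rfl | ⟨v, hv⟩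
  · simp
  · exact (Set.ncard_le_ncard (fun w hw => h v hv w hw) (Set.toFinite _)).trans
      (Finset.le_sup (f := fun v => (ball G v D).ncard) (Finset.mem_univ v))

theorem IsSeparated.pairwiseDisjoint {V : Type*} {G : SimpleGraph V} {r : ℝ} (hr : 0 < r)
    {𝓑 : Set (Set V)} (h : IsSeparated G r 𝓑) : 𝓑.PairwiseDisjoint id := by
  intro A hA B hB hAB
  refine Set.disjoint_left.mpr fun v hvA hvB => ?_
  have := h A hA B hB hAB v hvA v hvB (SimpleGraph.Reachable.refl v)
  rw [SimpleGraph.dist_self, Nat.cast_zero] at this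
  exact hr.not_ge this

/-- This is where `2 ≤ r` matters: distinct qubits in the support of one generator are at distance
one. -/
theorem IsSeparated.notMem_supp {n : ℕ} {gens : Set (UGroup n)} {r : ℝ} (hr : 2 ≤ r)
    {𝓑 : Set (Set (Fin n))} (h : IsSeparated (connectivityGraph gens) r 𝓑) {A B : Set (Fin n)}
    (hA : A ∈ 𝓑) (hB : B ∈ 𝓑) (hAB : A ≠ B) {g : UGroup n} (hg : g ∈ gens) {i j : Fin n}
    (hi : i ∈ A) (hj : j ∈ B) (his : i ∈ supp (g : Op (Fin n))) :
    j ∉ supp (g : Op (Fin n)) := by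
  intro hjs
  have hij : i ≠ j := by
    rintro rfl
    exact (h.pairwiseDisjoint (by linarith) hA hB hAB).notMem_of_mem_left hi hj
  have hadj : (connectivityGraph gens).Adj i j := ⟨hij, g, hg, his, hjs⟩
  have := h A hA B hB hAB i hi j hj hadj.reachable
  rw [SimpleGraph.dist_eq_one_iff_adj.mpr hadj, Nat.cast_one] at this
  linarith

theorem distance_le_bMax {n k : ℕ} {S : Subgroup (UGroup n)} (hS : IsStabilizerGroup S)
    {gens : Set (UGroup n)} (hgens : Subgroup.closure gens = S)
    (hk : Encodes (codeSpace S) k) (hk1 : 1 ≤ k) {r c : ℝ} (hr : 2 ≤ r)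
    (hN : NagataDimAtMost (connectivityGraph gens) 1 r c) :
    distance (codeSpace S) ≤ (bMax (connectivityGraph gens) (c * r) : ℕ∞) := by
  classical
  by_contra! hlt
  obtain ⟨-, 𝓑, hcover, hsep, hbdd⟩ := hN
  have hsub : gens ⊆ S := hgens ▸ Subgroup.subset_closure
  have hpiece : ∀ i, ActsAsScalar gens (codeSpace S) (⋃₀ 𝓑 i) := by
    intro i
    refine ActsAsScalar.sUnion (fun g hg => hS.1 g (hsub hg)) (fun B hB => ?_)
      ((hsep i).pairwiseDisjoint (by linarith))
      fun A hA B hB hAB g hg u hu v hv => (hsep i).notMem_supp hr hA hB hAB hg hu hv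
    have hcard := ncard_le_bMax (hbdd i B hB)
    rw [Set.ncard_eq_toFinset_card'] at hcard
    have := (correctable_of_card_lt_distance
      (lt_of_le_of_lt (Nat.cast_le.mpr hcard) hlt)).actsAsScalar hgens
    rwa [Set.coe_toFinset] at this
  have h0 : ActsAsScalar gens (codeSpace S) ((⋃₀ 𝓑 0).toFinset : Set (Fin n)) := by
    rw [Set.coe_toFinset]
    exact hpiece 0
  have h1 : ActsAsScalar gens (codeSpace S) {v | v ∉ (⋃₀ 𝓑 0).toFinset} := by
    -- The two unions may overlap, so the second is cut down to the complement of the first.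
    refine (hpiece 1).mono fun v hv => ?_
    have hmem : v ∈ ⋃ i, ⋃ B ∈ 𝓑 i, B := hcover ▸ Set.mem_univ v
    simp only [Set.mem_iUnion] at hmem
    obtain ⟨i, B, hB, hvB⟩ := hmem
    fin_cases i
    · exact absurd (Set.mem_toFinset.mpr (Set.mem_sUnion_of_mem hvB hB)) hv
    · exact ⟨B, hB, hvB⟩
  obtain ⟨φ, hφ, ψ, hψ, hφ0, hψ0, horth⟩ := exists_orthogonal_of_encodes hk hk1
  exact h0.dotProduct_ne_zero hS.1 hsub h1 hφ hψ hφ0 hψ0 horth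

end QStab

theorem lemma2 (n k : ℕ) (S : Subgroup (QStab.UGroup n)) (hS : QStab.IsStabilizerGroup S)
    (gens : Set (QStab.UGroup n)) (hgens : Subgroup.closure gens = S)
    (hk : QStab.Encodes (QStab.codeSpace S) k) (hk1 : 1 ≤ k) (c : ℝ) :
    (QStab.NagataDimAtMost (QStab.connectivityGraph gens) 1 2 c →
      QStab.distance (QStab.codeSpace S) ≤
        (QStab.bMax (QStab.connectivityGraph gens) (2 * c) : ℕ∞)) ∧
    ∀ r : ℝ, 2 ≤ r → QStab.NagataDimAtMost (QStab.connectivityGraph gens) 1 r c →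
      QStab.distance (QStab.codeSpace S) ≤
        (QStab.bMax (QStab.connectivityGraph gens) (c * r) : ℕ∞) := by
  refine ⟨fun hN => ?_, fun r hr hN => QStab.distance_le_bMax hS hgens hk hk1 hr hN⟩
  rw [mul_comm]
  exact QStab.distance_le_bMax hS hgens hk hk1 le_rfl hN
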